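/- All graphs are finite and simple. In the domination game on a graph $G$, Dominator and Staller alternately choose vertices, each chosen vertex dominating (as a member of its closed neighbourhood) at least one vertex not dominated before; the game ends when all vertices are dominated. Dominator wants the number of moves to be as small as possible, Staller as large as possible. Let $\gamma_g'(G)$ be the number of moves under optimal play when Staller moves first. For an edge $e$ of $G$, $G-e$ is $G$ with $e$ deleted. Let $B$ be the star $K_{1,4}$ with centre $x$ together with one edge joining two of its leaves, and let $e$ be one of the two edges at $x$ lying on the triangle of $B$. Let $Z$ be the graph on $\{v_0,\dots,v_8\}$ with edges $v_0v_1$, $v_1v_2$, $v_2v_3$, $v_3v_8$, $v_8v_7$, $v_7v_6$, $v_6v_5$, $v_5v_0$, $v_6v_1$, $v_7v_4$, $v_4v_3$, $v_4v_8$, $v_2v_7$, and put $z=v_8$. For $k\ge 0$ let $U_k$ be the graph obtained from the disjoint union of the cycle $C_6$ and $B$ by joining a vertex of $C_6$ to $x$ and then identifying one end vertex of each of $k$ copies of the path $P_6$ on six vertices with $x$. Let $V_k$ be obtained in the same way with $C_6$ replaced by $Z$, the vertex joined to $x$ being $z$. Proposition. For every $\ell\ge 4$ there is a connected graph $G$ with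 an edge $e$ such that $G-e$ is connected, $\gamma_g'(G)=\ell$ and $\gamma_g'(G-e)=\ell+2$. More precisely, for every $k\ge 0$ the graphs $U_k$, $U_k-e$, $V_k$, $V_k-e$ are connected and $$\gamma_g'(U_k)=2k+4,\quad \gamma_g'(U_k-e)=2k+6,\quad \gamma_g'(V_k)=2k+5,\quad \gamma_g'(V_k-e)=2k+7.$$ For $\ell<4$ there is no graph $G$, connected or not, with an edge $e$ such that $\gamma_g'(G)=\ell$ and $\gamma_g'(G-e)=\ell+2$. Moreover, for every graph $G$ and every edge $e$ of $G$: if $\gamma_g'(G)=1$ then $\gamma_g'(G-e)=2$; if $\gamma_g'(G)=2$ then $\gamma_g'(G-e)\le 3$; if $\gamma_g'(G)=3$ then $\gamma_g'(G-e)\le 4$. -/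

import Mathlib

namespace DominationGame

/-- The two players of the domination game. -/
inductive Player where
  | dominator
  | staller

section Game

variable {V : Type*} [Fintype V]

open Classical in
/-- The closed neighbourhood `N[v]`: the vertices dominated by `v`. -/
noncomputable def closedNbhd (G : SimpleGraph V) (v : V) : Finset V :=
  Finset.univ.filter fun w => w = v ∨ G.Adj v w

open Classical in
/-- The legal moves when `D` is the set of vertices dominated so far: a chosen vertex has to
dominate at least one vertex outside `D`. -/
noncomputable def legalMoves (G : SimpleGraph V) (D : Finset V) : Finset V :=
  Finset.univ.filter fun v => ¬ closedNbhd G v ⊆ D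

open Classical in
theorem card_compl_union_lt (G : SimpleGraph V) {D : Finset V} {v : V}
    (hv : v ∈ legalMoves G D) : ((D ∪ closedNbhd G v)ᶜ).card < (Dᶜ).card := by
  apply Finset.card_lt_card
  have hv' : ¬ closedNbhd G v ⊆ D := by simpa [legalMoves] using hv
  obtain ⟨w, hw, hwD⟩ := Finset.not_subset.mp hv'
  refine ⟨fun a ha => ?_, fun h => ?_⟩
  · simp only [Finset.mem_compl, Finset.mem_union, not_or] at ha ⊢
    exact ha.1
  · have := h (Finset.mem_compl.mpr hwD)
    simp only [Finset.mem_compl, Finset.mem_union, not_or] at this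
    exact this.2 hw

open Classical in
/-- A legal move exists exactly when some vertex is not yet dominated. -/
theorem legalMoves_nonempty_iff (G : SimpleGraph V) (D : Finset V) :
    (legalMoves G D).Nonempty ↔ D ≠ Finset.univ := by
  constructor
  · rintro ⟨v, hv⟩ rfl
    simp [legalMoves] at hv
  · intro h
    obtain ⟨v, hv⟩ : ∃ v, v ∉ D := by
      by_contra hc
      push Not at hc
      exact h (Finset.eq_univ_iff_forall.mpr hc)
    refine ⟨v, ?_⟩
    simp only [legalMoves, Finset.mem_filter, Finset.mem_univ, true_and]
    intro hs
    exact hv (hs (by simp [closedNbhd]))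

open Classical in
/-- The number of further moves made under optimal play when the vertices of `D` are already
dominated and it is the turn of the given player. Dominator minimizes and Staller maximizes the
number of moves; the game is over once there is no legal move, that is, once all vertices are
dominated (see `legalMoves_nonempty_iff`). -/
noncomputable def gameValue (G : SimpleGraph V) (p : Player) (D : Finset V) : ℕ :=
  if h : (legalMoves G D).Nonempty then
    match p with
    | .dominator => 1 + (legalMoves G D).attach.inf' (Finset.attach_nonempty_iff.mpr h)
        fun v => gameValue G .staller (D ∪ closedNbhd G v.1)
    | .staller => 1 + (legalMoves G D).attach.sup' (Finset.attach_nonempty_iff.mpr h)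
        fun v => gameValue G .dominator (D ∪ closedNbhd G v.1)
  else 0
termination_by (Dᶜ).card
decreasing_by all_goals exact card_compl_union_lt G v.2

/-- The Staller-start game domination number `γ_g'(G)`. -/
noncomputable def stallerStartNumber (G : SimpleGraph V) : ℕ :=
  gameValue G .staller ∅

end Game

/-- The graph `B`: the star `K_{1,4}` with centre `0`, plus the edge joining `3` and `4`. -/
def graphB : SimpleGraph (Fin 5) :=
  SimpleGraph.fromEdgeSet {s(0, 1), s(0, 2), s(0, 3), s(0, 4), s(3, 4)}

/-- The graph `Z` on nine vertices; its distinguished vertex `z` is `8`. -/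
def graphZ : SimpleGraph (Fin 9) :=
  SimpleGraph.fromEdgeSet
    {s(0, 1), s(1, 2), s(2, 3), s(3, 8), s(8, 7), s(7, 6), s(6, 5), s(5, 0),
      s(6, 1), s(7, 4), s(4, 3), s(4, 8), s(2, 7)}

/-- The vertices of the graph built from `H`, a copy of `B` and `k` pendant paths. -/
abbrev GadgetVertex (W : Type*) (k : ℕ) : Type _ := W ⊕ (Fin 5 ⊕ (Fin k × Fin 5))

/-- The graph obtained from the disjoint union of `H` and `B` by joining the vertex `h` of `H`
to the centre `x` of `B` and then identifying one end vertex of each of `k` copies of the path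
`P_6` with `x`. The `p`-th path has, besides `x`, the vertices `(p, 0), …, (p, 4)`, in this
order, with `(p, 0)` adjacent to `x`. -/
def gadget {W : Type*} (H : SimpleGraph W) (h : W) (k : ℕ) : SimpleGraph (GadgetVertex W k) :=
  SimpleGraph.fromRel fun a b =>
    match a, b with
    | .inl a, .inl b => H.Adj a b
    | .inl a, .inr (.inl i) => a = h ∧ i = 0
    | .inr (.inl i), .inr (.inl j) => graphB.Adj i j
    | .inr (.inl i), .inr (.inr (_, j)) => i = 0 ∧ j = 0
    | .inr (.inr (p, i)), .inr (.inr (q, j)) => p = q ∧ (SimpleGraph.pathGraph 5).Adj i j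
    | _, _ => False

/-- The edge `e`: one of the two edges at the centre `x` of `B` that lie on the triangle of `B`. -/
def gadgetEdge (W : Type*) (k : ℕ) : Sym2 (GadgetVertex W k) :=
  s(.inr (.inl 0), .inr (.inl 3))

/-- The graph `U_k`, built from the cycle `C_6`. -/
def graphU (k : ℕ) : SimpleGraph (GadgetVertex (Fin 6) k) :=
  gadget (SimpleGraph.cycleGraph 6) 0 k

/-- The graph `V_k`, built from the graph `Z`. -/
def graphV (k : ℕ) : SimpleGraph (GadgetVertex (Fin 9) k) :=
  gadget graphZ 8 k

end DominationGame

namespace DominationGame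

/-! ### Optimal play and monotonicity of the game value. -/

section Values

variable {V : Type*} [Fintype V] (G : SimpleGraph V)

/-! Everything rests on monotonicity: enlarging the dominated set never lengthens the game
(`gameValue_antitone`).

For the families, Dominator answers any opening with `x`, and by monotonicity only `N[x]` need be
counted as dominated; this bounds the value from above. Granting `x` and its path neighbours as
dominated in advance bounds it from below. In both positions each pendant path keeps four
consecutive undominated vertices, which absorb exactly two moves whoever starts and do not affect
the rest (`IsNeutralBlock.gameValue_eq`). So the paths contribute `2k`, and what remains is a game
on 11 or 14 vertices independent of `k`, settled by exhaustive search on bit masks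
(`gameValue_le_of_searchUpper`, `le_gameValue_of_searchLower`); the two bounds meet. After deleting
`e`, the answer `x` misses one triangle vertex, and the search shows that this costs two more moves.
`C_6` and `Z` supply the two parities.

For small values, Dominator keeps in `G - e` his reply from `G`. A vertex losing its domination is
an end of `e` whose other end was chosen, so two moves covering `G` miss at most one vertex of `G -
e`; for value 3 a case analysis shows that Dominator can always finish with his second move. -/

theorem mem_closedNbhd {v w : V} : w ∈ closedNbhd G v ↔ w = v ∨ G.Adj v w := by
  simp [closedNbhd]

theorem self_mem_closedNbhd (v : V) : v ∈ closedNbhd G v := by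
  simp [closedNbhd]

theorem mem_legalMoves {D : Finset V} {v : V} :
    v ∈ legalMoves G D ↔ ¬ closedNbhd G v ⊆ D := by
  simp [legalMoves]

theorem gameValue_univ (p : Player) : gameValue G p Finset.univ = 0 := by
  have : ¬ (legalMoves G Finset.univ).Nonempty := by
    simp [legalMoves_nonempty_iff]
  rw [gameValue.eq_def]
  simp [this]

open Classical in
theorem staller_move_le {D : Finset V} {v : V} (hv : v ∈ legalMoves G D) :
    gameValue G .dominator (D ∪ closedNbhd G v) + 1 ≤ gameValue G .staller D := by
  have h : (legalMoves G D).Nonempty := ⟨v, hv⟩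
  rw [gameValue.eq_def G .staller D]
  simp only [h, dif_pos]
  have := Finset.le_sup' (s := (legalMoves G D).attach)
    (fun v => gameValue G .dominator (D ∪ closedNbhd G v.1)) (Finset.mem_attach _ ⟨v, hv⟩)
  simp only at this
  omega

open Classical in
theorem exists_staller_move {D : Finset V} (hD : D ≠ Finset.univ) :
    ∃ v ∈ legalMoves G D,
      gameValue G .staller D = gameValue G .dominator (D ∪ closedNbhd G v) + 1 := by
  have h := (legalMoves_nonempty_iff G D).mpr hD
  rw [gameValue.eq_def G .staller D]
  simp only [h, dif_pos]
  obtain ⟨v, -, hv⟩ := Finset.exists_mem_eq_sup' (Finset.attach_nonempty_iff.mpr h)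
    (fun v => gameValue G .dominator (D ∪ closedNbhd G v.1))
  exact ⟨v.1, v.2, by rw [hv, Nat.add_comm]⟩

open Classical in
theorem dominator_le_move {D : Finset V} {v : V} (hv : v ∈ legalMoves G D) :
    gameValue G .dominator D ≤ gameValue G .staller (D ∪ closedNbhd G v) + 1 := by
  have h : (legalMoves G D).Nonempty := ⟨v, hv⟩
  rw [gameValue.eq_def G .dominator D]
  simp only [h, dif_pos]
  have := Finset.inf'_le (s := (legalMoves G D).attach)
    (fun v => gameValue G .staller (D ∪ closedNbhd G v.1)) (Finset.mem_attach _ ⟨v, hv⟩)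
  simp only at this
  omega

open Classical in
theorem exists_dominator_move {D : Finset V} (hD : D ≠ Finset.univ) :
    ∃ v ∈ legalMoves G D,
      gameValue G .dominator D = gameValue G .staller (D ∪ closedNbhd G v) + 1 := by
  have h := (legalMoves_nonempty_iff G D).mpr hD
  rw [gameValue.eq_def G .dominator D]
  simp only [h, dif_pos]
  obtain ⟨v, -, hv⟩ := Finset.exists_mem_eq_inf' (Finset.attach_nonempty_iff.mpr h)
    (fun v => gameValue G .staller (D ∪ closedNbhd G v.1))
  exact ⟨v.1, v.2, by rw [hv, Nat.add_comm]⟩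

theorem gameValue_pos {D : Finset V} (hD : D ≠ Finset.univ) (p : Player) :
    1 ≤ gameValue G p D := by
  cases p
  · obtain ⟨v, -, hv⟩ := exists_dominator_move G hD
    omega
  · obtain ⟨v, -, hv⟩ := exists_staller_move G hD
    omega

/-- The Continuation Principle. -/
theorem gameValue_antitone (p : Player) {D D' : Finset V} (h : D ⊆ D') :
    gameValue G p D' ≤ gameValue G p D := by
  classical
  induction hn : (D'ᶜ).card using Nat.strong_induction_on generalizing p D D' with
  | _ n ih =>
  by_cases hD' : D' = Finset.univ
  · rw [hD', gameValue_univ]; exact Nat.zero_le _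
  have hD : D ≠ Finset.univ := fun hD => hD' (Finset.univ_subset_iff.mp (hD ▸ h))
  have step {v : V} (hv : v ∈ legalMoves G D') (q : Player) {E : Finset V}
      (hE : E ⊆ D' ∪ closedNbhd G v) :
      gameValue G q (D' ∪ closedNbhd G v) ≤ gameValue G q E := by
    refine ih _ ?_ q hE rfl
    rw [← hn]
    convert card_compl_union_lt G hv
  cases p
  · obtain ⟨v, hv, hval⟩ := exists_dominator_move G hD
    have key {w : V} (hw : w ∈ legalMoves G D')
        (hs : D ∪ closedNbhd G v ⊆ D' ∪ closedNbhd G w) :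
        gameValue G .dominator D' ≤ gameValue G .dominator D := by
      -- Dominator copies his optimal move from `D`; if it is illegal at `D'`, its neighbourhood
      -- already lies in `D'` and any legal `w` serves.
      have h1 := dominator_le_move G hw
      have h2 := step hw .staller hs
      rw [hval]
      convert h1.trans (Nat.add_le_add_right (by convert h2) 1)
    by_cases hv' : v ∈ legalMoves G D'
    · exact key hv' (Finset.union_subset_union_left h)
    · obtain ⟨w, hw⟩ := (legalMoves_nonempty_iff G D').mpr hD'
      rw [mem_legalMoves, not_not] at hv'
      exact key hw ((Finset.union_subset h hv').trans Finset.subset_union_left)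
  · obtain ⟨v, hv, hval⟩ := exists_staller_move G hD'
    have hvD : v ∈ legalMoves G D :=
      (mem_legalMoves G).mpr fun hs => (mem_legalMoves G).mp hv (hs.trans h)
    have h1 := staller_move_le G hvD
    have h2 := step hv .dominator (Finset.union_subset_union_left (t := closedNbhd G v) h)
    rw [hval]
    refine le_trans (Nat.add_le_add_right ?_ 1) h1
    convert h2

theorem dominator_le_staller_add_one (D : Finset V) :
    gameValue G .dominator D ≤ gameValue G .staller D + 1 := by
  classical
  by_cases hD : D = Finset.univ
  · rw [hD, gameValue_univ]; exact Nat.zero_le _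
  obtain ⟨v, hv⟩ := (legalMoves_nonempty_iff G D).mpr hD
  exact (dominator_le_move G hv).trans
    (Nat.add_le_add_right (gameValue_antitone G _ Finset.subset_union_left) 1)

open Classical in
-- An illegal choice acts as a pass counted as a move, and passing never helps Dominator. Upper
-- bounds therefore need no legality check for his moves.
theorem dominator_le_any_move (D : Finset V) (v : V) :
    gameValue G .dominator D ≤ gameValue G .staller (D ∪ closedNbhd G v) + 1 := by
  by_cases hv : v ∈ legalMoves G D
  · exact dominator_le_move G hv
  · rw [mem_legalMoves, not_not] at hv
    rw [Finset.union_eq_left.mpr hv]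
    exact dominator_le_staller_add_one G D

open Classical in
theorem exists_of_dominator_le [Nonempty V] {D : Finset V} {n : ℕ}
    (h : gameValue G .dominator D ≤ n + 1) :
    ∃ v, gameValue G .staller (D ∪ closedNbhd G v) ≤ n := by
  by_cases hD : D = Finset.univ
  · refine ⟨Classical.arbitrary V, ?_⟩
    rw [hD, Finset.union_eq_left.mpr (Finset.subset_univ _), gameValue_univ]
    exact Nat.zero_le _
  · obtain ⟨v, -, hv⟩ := exists_dominator_move G hD
    exact ⟨v, by omega⟩

open Classical in
theorem staller_le_succ {D : Finset V} {n : ℕ}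
    (h : ∀ v ∈ legalMoves G D, gameValue G .dominator (D ∪ closedNbhd G v) ≤ n) :
    gameValue G .staller D ≤ n + 1 := by
  by_cases hD : D = Finset.univ
  · rw [hD, gameValue_univ]; exact Nat.zero_le _
  · obtain ⟨v, hv, hval⟩ := exists_staller_move G hD
    have := h v hv
    omega

theorem gameValue_eq_zero {p : Player} {D : Finset V} (h : gameValue G p D ≤ 0) :
    D = Finset.univ := by
  by_contra hD
  have := gameValue_pos G hD p
  omega

open Classical in
-- Dominator answers every opening with `x`, and what the opening itself dominated is discarded by
-- monotonicity.
theorem stallerStartNumber_le_of_move (x : V) :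
    stallerStartNumber G ≤ gameValue G .staller (closedNbhd G x) + 2 := by
  refine staller_le_succ G fun v _ => (dominator_le_any_move G _ x).trans ?_
  exact Nat.add_le_add_right (gameValue_antitone G _ Finset.subset_union_right) 1

end Values

/-! ### Edge deletion when the value is at most three. -/

section EdgeDeletion

theorem eq_of_mk_eq_mk {V : Type*} {e : Sym2 V} {v w p q : V} (h : e = s(v, p)) (h' : e = s(w, q)) (hq : q ≠ v) :
    p = q := by
  rw [h, Sym2.eq_iff] at h'
  rcases h' with h' | h'
  · exact h'.2
  · exact absurd h'.1.symm hq

variable {V : Type*} [Fintype V] (G : SimpleGraph V) {e : Sym2 V}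

theorem eq_mk_of_mem_closedNbhd {v p : V} (h : p ∈ closedNbhd G v)
    (h' : p ∉ closedNbhd (G.deleteEdges {e}) v) : e = s(v, p) := by
  rw [mem_closedNbhd] at h h'
  rw [SimpleGraph.deleteEdges_adj] at h'
  push Not at h'
  rcases h with h | h
  · exact absurd h h'.1
  · exact (h'.2 h).symm

theorem ne_of_notMem_closedNbhd {v p : V} (h : p ∉ closedNbhd G v) : p ≠ v := by
  rintro rfl
  exact h (self_mem_closedNbhd G p)

open Classical in
theorem exists_union_closedNbhd_eq_univ [Nonempty V] {D : Finset V}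
    (h : ∀ p q, p ∉ D → q ∉ D → p = q) : ∃ t, D ∪ closedNbhd G t = Finset.univ := by
  by_cases hD : D = Finset.univ
  · exact ⟨Classical.arbitrary V, by simp [hD]⟩
  · obtain ⟨t, ht⟩ := not_forall.mp (mt Finset.eq_univ_iff_forall.mpr hD)
    refine ⟨t, Finset.eq_univ_iff_forall.mpr fun p => ?_⟩
    by_cases hp : p ∈ D
    · exact Finset.mem_union_left _ hp
    · exact Finset.mem_union_right _ (h p t hp ht ▸ self_mem_closedNbhd G _)

open Classical in
theorem dominator_le_one {D : Finset V} {t : V} (h : D ∪ closedNbhd G t = Finset.univ) :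
    gameValue G .dominator D ≤ 1 := by
  have := dominator_le_any_move G D t
  rwa [h, gameValue_univ] at this

theorem staller_le_one {D : Finset V} (h : ∀ p q, p ∉ D → q ∉ D → p = q) :
    gameValue G .staller D ≤ 1 := by
  classical
  refine staller_le_succ G fun v hv => ?_
  obtain ⟨t, ht, htD⟩ := Finset.not_subset.mp ((mem_legalMoves G).mp hv)
  suffices D ∪ closedNbhd G v = Finset.univ by
    rw [this, gameValue_univ]
  refine Finset.eq_univ_iff_forall.mpr fun p => ?_
  by_cases hp : p ∈ D
  · exact Finset.mem_union_left _ hp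
  · exact Finset.mem_union_right _ (h p t hp htD ▸ ht)

theorem mem_legalMoves_empty (v : V) : v ∈ legalMoves G ∅ :=
  (mem_legalMoves G).mpr fun h => by simpa using h (self_mem_closedNbhd G v)

open Classical in
theorem dominator_first_move_le {n : ℕ} (h : stallerStartNumber G ≤ n + 1) (v : V) :
    gameValue G .dominator (closedNbhd G v) ≤ n := by
  have := staller_move_le G (mem_legalMoves_empty G v)
  rw [Finset.empty_union] at this
  unfold stallerStartNumber at h
  omega

theorem stallerStartNumber_le_succ {n : ℕ}
    (h : ∀ v, gameValue G .dominator (closedNbhd G v) ≤ n) : stallerStartNumber G ≤ n + 1 := by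
  classical
  refine staller_le_succ G fun v _ => ?_
  rw [Finset.empty_union]
  exact h v

theorem stallerStartNumber_deleteEdges_of_eq_one (he : e ∈ G.edgeSet)
    (h : stallerStartNumber G = 1) : stallerStartNumber (G.deleteEdges {e}) = 2 := by
  classical
  -- Value 1 forces `G` to be complete.
  have huniv (v p : V) : p ∈ closedNbhd G v := by
    rw [gameValue_eq_zero G (dominator_first_move_le G h.le v)]
    exact Finset.mem_univ p
  apply le_antisymm
  · refine stallerStartNumber_le_succ _ fun v => ?_
    have : Nonempty V := ⟨v⟩
    obtain ⟨t, ht⟩ := exists_union_closedNbhd_eq_univ (G.deleteEdges {e})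
      (D := closedNbhd (G.deleteEdges {e}) v) fun p q hp hq =>
        eq_of_mk_eq_mk (eq_mk_of_mem_closedNbhd G (huniv v p) hp)
          (eq_mk_of_mem_closedNbhd G (huniv v q) hq) (ne_of_notMem_closedNbhd _ hq)
    exact dominator_le_one _ ht
  · induction e with
    | _ a b =>
    have hab : G.Adj a b := he
    have h1 := staller_move_le _ (mem_legalMoves_empty (G.deleteEdges {s(a, b)}) a)
    have h2 : ∅ ∪ closedNbhd (G.deleteEdges {s(a, b)}) a ≠ Finset.univ := fun hu => by
      have := Finset.eq_univ_iff_forall.mp hu b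
      rw [Finset.empty_union, mem_closedNbhd, SimpleGraph.deleteEdges_adj] at this
      rcases this with h | h
      · exact hab.ne h.symm
      · exact h.2 rfl
    have h3 := gameValue_pos (G.deleteEdges {s(a, b)}) h2 .dominator
    unfold stallerStartNumber
    omega

open Classical in
/-- If two vertices dominate everything in `G`, then they miss at most one vertex in `G - e`. -/
theorem eq_of_notMem_union_closedNbhd {v w p q : V}
    (hp : p ∈ closedNbhd G v ∪ closedNbhd G w) (hq : q ∈ closedNbhd G v ∪ closedNbhd G w)
    (hp' : p ∉ closedNbhd (G.deleteEdges {e}) v ∪ closedNbhd (G.deleteEdges {e}) w)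
    (hq' : q ∉ closedNbhd (G.deleteEdges {e}) v ∪ closedNbhd (G.deleteEdges {e}) w) : p = q := by
  rw [Finset.mem_union, not_or] at hp' hq'
  rw [Finset.mem_union] at hp hq
  -- A lost vertex is an end of `e` whose other end is `v` or `w`. That other end is dominated, so
  -- it is not a second lost vertex.
  have hv := ne_of_notMem_closedNbhd _ hq'.1
  have hw := ne_of_notMem_closedNbhd _ hq'.2
  rcases hp with hp | hp <;> rcases hq with hq | hq
  · exact eq_of_mk_eq_mk (eq_mk_of_mem_closedNbhd G hp hp'.1)
      (eq_mk_of_mem_closedNbhd G hq hq'.1) hv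
  · exact eq_of_mk_eq_mk (eq_mk_of_mem_closedNbhd G hp hp'.1)
      (eq_mk_of_mem_closedNbhd G hq hq'.2) hv
  · exact eq_of_mk_eq_mk (eq_mk_of_mem_closedNbhd G hp hp'.2)
      (eq_mk_of_mem_closedNbhd G hq hq'.1) hw
  · exact eq_of_mk_eq_mk (eq_mk_of_mem_closedNbhd G hp hp'.2)
      (eq_mk_of_mem_closedNbhd G hq hq'.2) hw

theorem stallerStartNumber_deleteEdges_of_eq_two (h : stallerStartNumber G = 2) :
    stallerStartNumber (G.deleteEdges {e}) ≤ 3 := by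
  classical
  refine stallerStartNumber_le_succ _ fun v => ?_
  have : Nonempty V := ⟨v⟩
  obtain ⟨w, hw⟩ := exists_of_dominator_le G (dominator_first_move_le G h.le v)
  have hu := Finset.eq_univ_iff_forall.mp (gameValue_eq_zero G hw)
  exact (dominator_le_any_move _ _ w).trans (Nat.add_le_add_right
    (staller_le_one _ fun p q => eq_of_notMem_union_closedNbhd G (hu p) (hu q)) 1)

open Classical in
-- Dominator copies his reply `w` from `G`. Whatever Staller then plays, a single vertex completes
-- the domination of `G - e`.
theorem stallerStartNumber_deleteEdges_of_eq_three (h : stallerStartNumber G = 3) :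
    stallerStartNumber (G.deleteEdges {e}) ≤ 4 := by
  refine stallerStartNumber_le_succ _ fun v => ?_
  have : Nonempty V := ⟨v⟩
  obtain ⟨w, hw⟩ := exists_of_dominator_le G (dominator_first_move_le G h.le v)
  -- In `G` at most one move is left after `v` and `w`, so every legal move there finishes the game.
  have hlegal {u r : V} (hru : r ∈ closedNbhd G u) (hr : r ∉ closedNbhd G v ∪ closedNbhd G w)
      (p : V) : p ∈ closedNbhd G v ∪ closedNbhd G w ∪ closedNbhd G u := by
    have := staller_move_le G ((mem_legalMoves G).mpr fun hs => hr (hs hru))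
    exact Finset.eq_univ_iff_forall.mp
      (gameValue_eq_zero G (Nat.le_of_succ_le_succ (this.trans hw))) p
  refine (dominator_le_any_move _ _ w).trans (Nat.add_le_add_right
    (staller_le_succ _ fun u hu => ?_) 1)
  obtain ⟨z, hzu, hz⟩ := Finset.not_subset.mp ((mem_legalMoves _).mp hu)
  suffices ∃ t, closedNbhd (G.deleteEdges {e}) v ∪ closedNbhd (G.deleteEdges {e}) w ∪
      closedNbhd (G.deleteEdges {e}) u ∪ closedNbhd (G.deleteEdges {e}) t = Finset.univ by
    obtain ⟨t, ht⟩ := this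
    exact dominator_le_one _ ht
  -- Here `z` is newly dominated by Staller's `u`. If `v` and `w` dominated it in `G`, it is the one
  -- vertex lost to the deletion.
  by_cases hzG : z ∈ closedNbhd G v ∪ closedNbhd G w
  · by_cases hR : ∃ r, r ∉ closedNbhd G v ∪ closedNbhd G w
    · obtain ⟨r, hr⟩ := hR
      -- `r` finishes the game in `G`. It fails in `G - e` only if `e` is incident with `r`; but `e`
      -- joins `z` to `v` or `w`, and `r` is none of these.
      refine ⟨r, Finset.eq_univ_iff_forall.mpr fun p => ?_⟩
      by_contra hp
      rw [Finset.mem_union, Finset.mem_union, not_or, not_or] at hp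
      obtain ⟨⟨hp, hpu⟩, hpr⟩ := hp
      by_cases hpG : p ∈ closedNbhd G v ∪ closedNbhd G w
      · exact hpu (eq_of_notMem_union_closedNbhd G hpG hzG hp hz ▸ hzu)
      have hpr' := (Finset.mem_union.mp (hlegal (self_mem_closedNbhd G r) hr p)).resolve_left hpG
      have her := eq_mk_of_mem_closedNbhd G hpr' hpr
      rw [Finset.mem_union, not_or] at hz hr hpG
      rw [Finset.mem_union] at hzG
      rcases hzG with hzG | hzG
      · have hev := eq_mk_of_mem_closedNbhd G hzG hz.1
        rw [her, Sym2.eq_iff] at hev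
        rcases hev with hev | hev
        · exact hr.1 (hev.1 ▸ self_mem_closedNbhd G _)
        · exact hr.1 (hev.1 ▸ hzG)
      · have hew := eq_mk_of_mem_closedNbhd G hzG hz.2
        rw [her, Sym2.eq_iff] at hew
        rcases hew with hew | hew
        · exact hr.2 (hew.1 ▸ self_mem_closedNbhd G _)
        · exact hr.2 (hew.1 ▸ hzG)
    · push Not at hR
      -- Only `z` was missing and `u` dominates it, so the final vertex is arbitrary.
      refine ⟨u, Finset.eq_univ_iff_forall.mpr fun p => ?_⟩
      by_contra hp
      rw [Finset.mem_union, Finset.mem_union, not_or, not_or] at hp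
      exact hp.1.2 (eq_of_notMem_union_closedNbhd G (hR p) hzG hp.1.1 hz ▸ hzu)
  · have hzu' : z ∈ closedNbhd G u := by
      rw [mem_closedNbhd] at hzu ⊢
      exact hzu.imp_right fun h => (SimpleGraph.deleteEdges_adj.mp h).1
    have hcover := hlegal hzu' hzG
    -- Now `u` is legal in `G` too, so `v`, `w`, `u` cover `G`. Any vertex missed in `G - e` is an
    -- end of `e` with its other end dominated, so there is at most one.
    have edge (p : V) (hp : p ∉ closedNbhd (G.deleteEdges {e}) v ∪
        closedNbhd (G.deleteEdges {e}) w ∪ closedNbhd (G.deleteEdges {e}) u) :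
        ∃ a, e = s(a, p) ∧ a ∈ closedNbhd (G.deleteEdges {e}) v ∪
          closedNbhd (G.deleteEdges {e}) w ∪ closedNbhd (G.deleteEdges {e}) u := by
      have hp1 := hcover p
      simp only [Finset.mem_union, not_or] at hp hp1 ⊢
      rcases hp1 with (h1 | h1) | h1
      · exact ⟨v, eq_mk_of_mem_closedNbhd G h1 hp.1.1, .inl (.inl (self_mem_closedNbhd _ v))⟩
      · exact ⟨w, eq_mk_of_mem_closedNbhd G h1 hp.1.2, .inl (.inr (self_mem_closedNbhd _ w))⟩
      · exact ⟨u, eq_mk_of_mem_closedNbhd G h1 hp.2, .inr (self_mem_closedNbhd _ u)⟩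
    refine exists_union_closedNbhd_eq_univ _ fun p q hp hq => ?_
    obtain ⟨a, hea, ha⟩ := edge p hp
    obtain ⟨b, heb, hb⟩ := edge q hq
    exact eq_of_mk_eq_mk hea heb fun hqa => hq (hqa ▸ ha)

theorem stallerStartNumber_ne_zero [Nonempty V] : stallerStartNumber G ≠ 0 := fun h =>
  (Finset.univ_nonempty (α := V)).ne_empty (gameValue_eq_zero G h.le).symm

end EdgeDeletion

/-! ### Blocks that absorb exactly two moves. -/

section NeutralBlock

variable {V : Type*} [Fintype V] (G : SimpleGraph V)

open Classical in
/-- A set `P` of undominated vertices on which exactly two moves will be made, without any effect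
on the rest of the game, if the vertices of `D` are dominated. -/
structure IsNeutralBlock (D P : Finset V) : Prop where
  disjoint : ∀ p ∈ P, p ∉ D
  closed : ∀ v, ∀ p ∈ P, p ∈ closedNbhd G v → closedNbhd G v ⊆ D ∪ P
  not_single : ∀ v, ¬ P ⊆ closedNbhd G v
  reply : ∀ v, ∀ p ∈ P, p ∈ closedNbhd G v → ∃ w, P ⊆ closedNbhd G v ∪ closedNbhd G w
  -- Needed only when Dominator must open the block because nothing else is left: after `u`, Staller
  -- cannot prolong play to a third move.
  start : ∃ u, (∃ p ∈ P, p ∈ closedNbhd G u) ∧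
    ∀ w, ∀ p ∈ P, p ∈ closedNbhd G w → p ∉ closedNbhd G u → P ⊆ closedNbhd G u ∪ closedNbhd G w

variable {G}

open Classical in
theorem IsNeutralBlock.mono {D D' P : Finset V} (h : IsNeutralBlock G D P) (hD : D ⊆ D')
    (hP : ∀ p ∈ P, p ∉ D') : IsNeutralBlock G D' P where
  disjoint := hP
  closed v p hp hv := (h.closed v p hp hv).trans (Finset.union_subset_union_left hD)
  not_single := h.not_single
  reply := h.reply
  start := h.start

open Classical in
theorem IsNeutralBlock.union_closedNbhd {D P : Finset V} (h : IsNeutralBlock G D P) {v : V}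
    (hv : ∀ p ∈ P, p ∉ closedNbhd G v) : IsNeutralBlock G (D ∪ closedNbhd G v) P :=
  h.mono Finset.subset_union_left fun p hp hpv =>
    (Finset.mem_union.mp hpv).elim (h.disjoint p hp) (hv p hp)

open Classical in
/-- The two moves by which a neutral block gets dominated. -/
theorem IsNeutralBlock.exists_finish {D P : Finset V} (h : IsNeutralBlock G D P) {v p : V}
    (hp : p ∈ P) (hv : p ∈ closedNbhd G v) :
    ∃ w ∈ legalMoves G (D ∪ closedNbhd G v), D ∪ closedNbhd G v ∪ closedNbhd G w = D ∪ P := by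
  obtain ⟨w, hw⟩ := h.reply v p hp hv
  obtain ⟨q, hq, hqv⟩ := Finset.not_subset.mp (h.not_single v)
  have hqw : q ∈ closedNbhd G w := (Finset.mem_union.mp (hw hq)).resolve_left hqv
  refine ⟨w, (mem_legalMoves G).mpr fun hs => ?_, ?_⟩
  · exact (Finset.mem_union.mp (hs hqw)).elim (h.disjoint q hq) hqv
  · apply subset_antisymm
    · exact Finset.union_subset (Finset.union_subset Finset.subset_union_left
        (h.closed v p hp hv)) (h.closed w q hq hqw)
    · rw [Finset.union_assoc]
      exact Finset.union_subset_union_right hw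

open Classical in
theorem IsNeutralBlock.notMem_of_legal {D P : Finset V} (h : IsNeutralBlock G D P) {v : V}
    (hv : v ∈ legalMoves G (D ∪ P)) : ∀ p ∈ P, p ∉ closedNbhd G v := fun p hp hpv =>
  (mem_legalMoves G).mp hv (h.closed v p hp hpv)

open Classical in
theorem IsNeutralBlock.legal_union {D P : Finset V} {v : V}
    (hv : v ∈ legalMoves G D) (hvP : ∀ p ∈ P, p ∉ closedNbhd G v) : v ∈ legalMoves G (D ∪ P) :=
  (mem_legalMoves G).mpr fun hs => (mem_legalMoves G).mp hv fun _ hw =>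
    (Finset.mem_union.mp (hs hw)).resolve_right fun hP => hvP _ hP hw

open Classical in
theorem IsNeutralBlock.legal_of_union {D P : Finset V} {v : V}
    (hv : v ∈ legalMoves G (D ∪ P)) : v ∈ legalMoves G D :=
  (mem_legalMoves G).mpr fun hs => (mem_legalMoves G).mp hv (hs.trans Finset.subset_union_left)

open Classical in
/-- If nothing but the block is left, it takes two moves. -/
theorem IsNeutralBlock.gameValue_of_union_eq_univ {D P : Finset V} (h : IsNeutralBlock G D P)
    (hD : D ∪ P = Finset.univ) (p : Player) : gameValue G p D = 2 := by
  obtain ⟨u, ⟨a, ha, hau⟩, hu⟩ := h.start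
  have hne : D ≠ Finset.univ := fun h' => h.disjoint a ha (h' ▸ Finset.mem_univ a)
  have hlegal {v q : V} (hq : q ∈ P) (hv : q ∈ closedNbhd G v) : v ∈ legalMoves G D :=
    (mem_legalMoves G).mpr fun hs => h.disjoint q hq (hs hv)
  have htouch {E : Finset V} {v : V} (hE : D ⊆ E) (hv : v ∈ legalMoves G E) :
      ∃ q ∈ P, q ∈ closedNbhd G v ∧ q ∉ E := by
    obtain ⟨q, hq, hqD⟩ := Finset.not_subset.mp ((mem_legalMoves G).mp hv)
    exact ⟨q, (Finset.mem_union.mp (hD ▸ Finset.mem_univ q)).resolve_left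
      fun hqD' => hqD (hE hqD'), hq, hqD⟩
  have hpos (v : V) : D ∪ closedNbhd G v ≠ Finset.univ := fun h' => by
    obtain ⟨q, hq, hqv⟩ := Finset.not_subset.mp (h.not_single v)
    exact (Finset.mem_union.mp (h' ▸ Finset.mem_univ q)).elim (h.disjoint q hq) hqv
  have hfin {w q : V} (hE : D ∪ closedNbhd G w ∪ closedNbhd G q = D ∪ P) (p : Player) :
      gameValue G p (D ∪ closedNbhd G w ∪ closedNbhd G q) = 0 := by
    rw [hE, hD, gameValue_univ]
  cases p
  · apply le_antisymm
    · refine (dominator_le_move G (hlegal ha hau)).trans (Nat.succ_le_succ ?_)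
      refine staller_le_succ G fun w hw => ?_
      obtain ⟨q, hqP, hqw, hqD⟩ := htouch Finset.subset_union_left hw
      have hs := hu w q hqP hqw fun hqu => hqD (Finset.mem_union_right _ hqu)
      have hE : D ∪ closedNbhd G u ∪ closedNbhd G w = Finset.univ := by
        rw [Finset.union_assoc, ← Finset.univ_subset_iff, ← hD]
        exact Finset.union_subset_union_right hs
      rw [hE, gameValue_univ]
    · obtain ⟨v, -, hval⟩ := exists_dominator_move G hne
      have := gameValue_pos G (hpos v) .staller
      omega
  · apply le_antisymm
    · refine staller_le_succ G fun v hv => ?_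
      obtain ⟨q, hqP, hqv, -⟩ := htouch subset_rfl hv
      obtain ⟨w, hw, hE⟩ := h.exists_finish hqP hqv
      exact (dominator_le_move G hw).trans (Nat.succ_le_succ (hfin hE _).le)
    · have h1 := staller_move_le G (hlegal ha hau)
      have := gameValue_pos G (hpos u) .dominator
      omega

open Classical in
/-- A neutral block adds exactly two moves to the game. -/
theorem IsNeutralBlock.gameValue_eq {D P : Finset V} (h : IsNeutralBlock G D P) (p : Player) :
    gameValue G p D = gameValue G p (D ∪ P) + 2 := by
  induction hn : (Dᶜ).card using Nat.strong_induction_on generalizing p D with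
  | _ n ih =>
  by_cases hD : D ∪ P = Finset.univ
  · rw [h.gameValue_of_union_eq_univ hD, hD, gameValue_univ]
  have hne : D ≠ Finset.univ := fun h' => hD (by
    rw [h']; exact Finset.union_eq_left.mpr (Finset.subset_univ _))
  have step {v : V} (hv : v ∈ legalMoves G D) (hvP : ∀ p ∈ P, p ∉ closedNbhd G v) (q : Player) :
      gameValue G q (D ∪ closedNbhd G v) = gameValue G q (D ∪ P ∪ closedNbhd G v) + 2 := by
    rw [ih _ (hn ▸ card_compl_union_lt G hv) (h.union_closedNbhd hvP) q rfl, Finset.union_right_comm]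
  cases p
  · apply le_antisymm
    -- Each player follows an optimal strategy for `D ∪ P`. If the opponent enters the block, he
    -- completes it at once, and the same opponent is to move again.
    · obtain ⟨v, hv, hval⟩ := exists_dominator_move G hD
      have h1 := dominator_le_move G (IsNeutralBlock.legal_of_union hv)
      rw [step (IsNeutralBlock.legal_of_union hv) (h.notMem_of_legal hv)] at h1
      omega
    · obtain ⟨v, hv, hval⟩ := exists_dominator_move G hne
      by_cases hvP : ∃ p ∈ P, p ∈ closedNbhd G v
      · obtain ⟨q, hq, hqv⟩ := hvP
        obtain ⟨w, hw, hE⟩ := h.exists_finish hq hqv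
        have h1 := staller_move_le G hw
        rw [hE] at h1
        omega
      · push Not at hvP
        have h1 := dominator_le_move G (IsNeutralBlock.legal_union hv hvP)
        rw [step hv hvP] at hval
        omega
  · apply le_antisymm
    · obtain ⟨v, hv, hval⟩ := exists_staller_move G hne
      by_cases hvP : ∃ p ∈ P, p ∈ closedNbhd G v
      · obtain ⟨q, hq, hqv⟩ := hvP
        obtain ⟨w, hw, hE⟩ := h.exists_finish hq hqv
        have h1 := dominator_le_move G hw
        rw [hE] at h1
        omega
      · push Not at hvP
        have h1 := staller_move_le G (IsNeutralBlock.legal_union hv hvP)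
        rw [step hv hvP] at hval
        omega
    · obtain ⟨v, hv, hval⟩ := exists_staller_move G hD
      have h1 := staller_move_le G (IsNeutralBlock.legal_of_union hv)
      rw [step (IsNeutralBlock.legal_of_union hv) (h.notMem_of_legal hv)] at h1
      omega

open Classical in
theorem gameValue_biUnion_neutralBlocks {ι : Type*} (P : ι → Finset V) {D : Finset V}
    (h : ∀ i, IsNeutralBlock G D (P i)) (hP : ∀ i j, i ≠ j → ∀ p ∈ P i, p ∉ P j)
    (s : Finset ι) (p : Player) :
    gameValue G p D = gameValue G p (D ∪ s.biUnion P) + 2 * s.card := by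
  induction s using Finset.induction_on with
  | empty => simp
  | insert i s hi ih =>
    have hblock : IsNeutralBlock G (D ∪ s.biUnion P) (P i) := by
      refine (h i).mono Finset.subset_union_left fun q hq hq' => ?_
      rcases Finset.mem_union.mp hq' with hq' | hq'
      · exact (h i).disjoint q hq hq'
      · obtain ⟨j, hj, hqj⟩ := Finset.mem_biUnion.mp hq'
        exact hP i j (fun hij => hi (hij ▸ hj)) q hq hqj
    rw [ih, hblock.gameValue_eq, Finset.biUnion_insert, Finset.card_insert_of_notMem hi,
      Finset.union_assoc, Finset.union_comm (P i)]
    ring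

end NeutralBlock

/-! ### Exhaustive search on bit masks. -/

section Search

/-- Search for a proof that at most `k` moves remain. Sets of vertices are coded by the binary
digits of numbers; `N` lists the closed neighbourhoods, `m` is the set of dominated vertices. -/
def searchUpper (N : List ℕ) : ℕ → Player → ℕ → Bool
  | 0, _, m => N.all fun t => Nat.beq (Nat.lor m t) m
  | k + 1, .staller, m =>
    N.all fun t => Nat.beq (Nat.lor m t) m || searchUpper N k .dominator (Nat.lor m t)
  | k + 1, .dominator, m =>
    -- No legality test: a useless choice is a counted pass.
    N.any fun t => searchUpper N k .staller (Nat.lor m t)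

/-- Search for a proof that at least `k` moves remain. Staller's moves are tried in the order of
the list `N'`. -/
def searchLower (N N' : List ℕ) : ℕ → Player → ℕ → Bool
  | 0, _, _ => true
  | k + 1, .staller, m => N'.any fun t =>
    !Nat.beq (Nat.lor m t) m && searchLower N N' k .dominator (Nat.lor m t)
  -- Without the first conjunct a finished game would satisfy the second one vacuously.
  | k + 1, .dominator, m => (N.any fun t => !Nat.beq (Nat.lor m t) m) &&
    N.all fun t => Nat.beq (Nat.lor m t) m || searchLower N N' k .staller (Nat.lor m t)

variable {V : Type*} {n : ℕ}

/-- The number `m` codes the part of `D` that lies in the range of `b`. -/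
structure Codes (b : Fin n → V) (D : Finset V) (m : ℕ) : Prop where
  lt : m < 2 ^ n
  mem_iff : ∀ i, b i ∈ D ↔ m.testBit i = true

open Classical in
theorem Codes.union {b : Fin n → V} {D E : Finset V} {m t : ℕ} (h : Codes b D m)
    (h' : Codes b E t) : Codes b (D ∪ E) (Nat.lor m t) where
  lt := Nat.or_lt_two_pow h.lt h'.lt
  mem_iff i := by
    change _ ↔ (m ||| t).testBit i = true
    rw [Nat.testBit_or, Bool.or_eq_true, ← h.mem_iff, ← h'.mem_iff, Finset.mem_union]

variable [Fintype V] {G : SimpleGraph V} {b : Fin n → V} {f : Fin n → ℕ}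

/-- A move is illegal exactly when its mask adds no bit. Masks see only the range of `b`, so
everything outside must already be dominated. -/
theorem Codes.mem_legalMoves_iff (hf : ∀ i, Codes b (closedNbhd G (b i)) (f i)) {D : Finset V}
    {m : ℕ} (hD : Codes b D m) (hout : ∀ v, v ∉ Set.range b → v ∈ D) (i : Fin n) :
    b i ∈ legalMoves G D ↔ Nat.beq (Nat.lor m (f i)) m = false := by
  rw [mem_legalMoves, ← Bool.not_eq_true, not_iff_not, Nat.beq_eq]
  change _ ↔ m ||| f i = m
  constructor
  · intro hs
    refine Nat.eq_of_testBit_eq fun j => ?_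
    rw [Nat.testBit_or]
    by_cases hj : j < n
    · have h1 := (hf i).mem_iff ⟨j, hj⟩
      have h2 := hD.mem_iff ⟨j, hj⟩
      by_cases hb : (f i).testBit j = true
      · rw [h2.mp (hs (h1.mpr hb)), Bool.true_or]
      · rw [Bool.not_eq_true] at hb
        rw [hb, Bool.or_false]
    · have : (f i).testBit j = false :=
        Nat.testBit_lt_two_pow ((hf i).lt.trans_le (Nat.pow_le_pow_right two_pos (not_lt.mp hj)))
      rw [this, Bool.or_false]
  · intro hm v hv
    by_cases hvb : v ∈ Set.range b
    · obtain ⟨j, rfl⟩ := hvb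
      rw [hD.mem_iff, ← hm, Nat.testBit_or, ((hf i).mem_iff j).mp hv, Bool.or_true]
    · exact hout v hvb

/-- The vertices outside the range of `b` play no role any more. -/
def Idle (G : SimpleGraph V) (b : Fin n → V) (D : Finset V) : Prop :=
  ∀ v, v ∉ Set.range b → closedNbhd G v ⊆ D

open Classical in
theorem gameValue_le_of_searchUpper (hf : ∀ i, Codes b (closedNbhd G (b i)) (f i)) {k : ℕ}
    {p : Player} {D : Finset V} {m : ℕ} (hD : Codes b D m) (hidle : Idle G b D)
    (h : searchUpper (List.ofFn f) k p m = true) : gameValue G p D ≤ k := by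
  induction k generalizing p D m with
  | zero =>
    suffices D = Finset.univ by rw [this, gameValue_univ]
    by_contra hne
    obtain ⟨v, hv⟩ := (legalMoves_nonempty_iff G D).mpr hne
    have hvb : v ∈ Set.range b := by
      by_contra hvb
      exact (mem_legalMoves G).mp hv (hidle v hvb)
    obtain ⟨i, rfl⟩ := hvb
    rw [hD.mem_legalMoves_iff hf fun v hv => hidle v hv (self_mem_closedNbhd G v)] at hv
    rw [searchUpper, List.all_eq_true] at h
    rw [h (f i) (List.mem_ofFn.mpr ⟨i, rfl⟩)] at hv
    exact absurd hv (by decide)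
  | succ k ih =>
    have hnext (i : Fin n) (q : Player) :
        searchUpper (List.ofFn f) k q (Nat.lor m (f i)) = true →
          gameValue G q (D ∪ closedNbhd G (b i)) ≤ k :=
      ih (hD.union (hf i)) fun v hv => (hidle v hv).trans Finset.subset_union_left
    cases p
    · rw [searchUpper, List.any_eq_true] at h
      obtain ⟨t, ht, h⟩ := h
      obtain ⟨i, rfl⟩ := List.mem_ofFn.mp ht
      exact (dominator_le_any_move G D (b i)).trans (Nat.succ_le_succ (hnext i _ h))
    · rw [searchUpper, List.all_eq_true] at h
      refine staller_le_succ G fun v hv => ?_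
      have hvb : v ∈ Set.range b := by
        by_contra hvb
        exact (mem_legalMoves G).mp hv (hidle v hvb)
      obtain ⟨i, rfl⟩ := hvb
      rw [hD.mem_legalMoves_iff hf fun v hv => hidle v hv (self_mem_closedNbhd G v)] at hv
      have h := h (f i) (List.mem_ofFn.mpr ⟨i, rfl⟩)
      rw [hv, Bool.false_or] at h
      exact hnext i _ h

open Classical in
theorem le_gameValue_of_searchLower (hf : ∀ i, Codes b (closedNbhd G (b i)) (f i)) {N' : List ℕ}
    (hN' : ∀ t ∈ N', t ∈ List.ofFn f) {k : ℕ}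
    {p : Player} {D : Finset V} {m : ℕ} (hD : Codes b D m) (hidle : Idle G b D)
    (h : searchLower (List.ofFn f) N' k p m = true) : k ≤ gameValue G p D := by
  induction k generalizing p D m with
  | zero => exact Nat.zero_le _
  | succ k ih =>
    have hnext (i : Fin n) (q : Player) :
        searchLower (List.ofFn f) N' k q (Nat.lor m (f i)) = true →
          k ≤ gameValue G q (D ∪ closedNbhd G (b i)) :=
      ih (hD.union (hf i)) fun v hv => (hidle v hv).trans Finset.subset_union_left
    have hlegal := hD.mem_legalMoves_iff hf fun v hv => hidle v hv (self_mem_closedNbhd G v)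
    cases p
    · rw [searchLower, Bool.and_eq_true, List.all_eq_true, List.any_eq_true] at h
      obtain ⟨⟨t, ht, hleg⟩, h⟩ := h
      obtain ⟨i, rfl⟩ := List.mem_ofFn.mp ht
      rw [Bool.not_eq_true', ← hlegal] at hleg
      obtain ⟨v, hv, hval⟩ :=
        exists_dominator_move G ((legalMoves_nonempty_iff G D).mp ⟨_, hleg⟩)
      have hvb : v ∈ Set.range b := by
        by_contra hvb
        exact (mem_legalMoves G).mp hv (hidle v hvb)
      obtain ⟨j, rfl⟩ := hvb
      have h := h (f j) (List.mem_ofFn.mpr ⟨j, rfl⟩)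
      rw [(hlegal j).mp hv, Bool.false_or] at h
      rw [hval]
      exact Nat.succ_le_succ (hnext j _ h)
    · rw [searchLower, List.any_eq_true] at h
      obtain ⟨t, ht, h⟩ := h
      obtain ⟨i, rfl⟩ := List.mem_ofFn.mp (hN' t ht)
      rw [Bool.and_eq_true, Bool.not_eq_true', ← hlegal] at h
      exact le_trans (Nat.succ_le_succ (hnext i _ h.2)) (staller_move_le G h.1)

end Search

/-! ### Pendant paths as neutral blocks. -/

section AttachedPaths

theorem Codes.congr {V : Type*} {n : ℕ} {b : Fin n → V} {D E : Finset V} {m : ℕ} (h : Codes b D m) (hE : ∀ i, b i ∈ E ↔ b i ∈ D) :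
    Codes b E m :=
  ⟨h.lt, fun i => (hE i).trans (h.mem_iff i)⟩

/-- The closed neighbourhood relation of the path on the five vertices `0, …, 4`. -/
def PathNear (i j : Fin 5) : Prop := j = i ∨ i.val + 1 = j.val ∨ j.val + 1 = i.val

instance (i j : Fin 5) : Decidable (PathNear i j) :=
  inferInstanceAs (Decidable (_ ∨ _ ∨ _))

/-- The vertices of `G` are the `b i` and the `a p j`, where `a p` is a pendant path attached to
`x`. -/
structure HasPaths {V ι : Type*} {n : ℕ} (G : SimpleGraph V) (b : Fin n → V) (x : Fin n)
    (a : ι → Fin 5 → V) : Prop where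
  cover : ∀ v, v ∈ Set.range b ∨ ∃ p i, v = a p i
  sep : ∀ i p j, b i ≠ a p j
  inj : ∀ p q i j, a p i = a q j → p = q ∧ i = j
  adj : ∀ p i v, G.Adj (a p i) v ↔
    (i = 0 ∧ v = b x) ∨ ∃ j, v = a p j ∧ (SimpleGraph.pathGraph 5).Adj i j

variable {V ι : Type*} [Fintype V] {n : ℕ} {G : SimpleGraph V} {b : Fin n → V} {x : Fin n}
  {a : ι → Fin 5 → V}

theorem HasPaths.mem_closedNbhd_iff (h : HasPaths G b x a) (p : ι) (i : Fin 5) (v : V) :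
    v ∈ closedNbhd G (a p i) ↔ (i = 0 ∧ v = b x) ∨ ∃ j, v = a p j ∧ PathNear i j := by
  rw [mem_closedNbhd, h.adj]
  simp only [SimpleGraph.pathGraph_adj, PathNear]
  constructor
  · rintro (hv | hv | ⟨j, hv, hj⟩)
    · exact .inr ⟨i, hv, .inl rfl⟩
    · exact .inl hv
    · exact .inr ⟨j, hv, .inr hj⟩
  · rintro (hv | ⟨j, hv, rfl | hj⟩)
    · exact .inr (.inl hv)
    · exact .inl hv
    · exact .inr (.inr ⟨j, hv, hj⟩)

theorem HasPaths.path_mem_closedNbhd_iff (h : HasPaths G b x a) (p : ι) (i j : Fin 5) :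
    a p j ∈ closedNbhd G (a p i) ↔ PathNear i j := by
  rw [h.mem_closedNbhd_iff]
  constructor
  · rintro (hv | ⟨k, hv, hk⟩)
    · exact absurd hv.2.symm (h.sep x p j)
    · rwa [(h.inj p p j k hv).2]
  · exact fun hj => .inr ⟨j, rfl, hj⟩

theorem HasPaths.eq_of_path_mem_closedNbhd (h : HasPaths G b x a) {p : ι} {j : Fin 5} {v : V}
    (hv : a p j ∈ closedNbhd G v) : (j = 0 ∧ v = b x) ∨ ∃ i, v = a p i ∧ PathNear i j := by
  have hv' : v ∈ closedNbhd G (a p j) := by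
    rw [mem_closedNbhd] at hv ⊢
    exact hv.imp Eq.symm SimpleGraph.Adj.symm
  refine ((h.mem_closedNbhd_iff p j v).mp hv').imp_right fun ⟨i, hi, hij⟩ => ⟨i, hi, ?_⟩
  revert hij
  unfold PathNear
  rintro (rfl | hij)
  · exact .inl rfl
  · exact .inr hij.symm

open Classical in
/-- The vertices of a pendant path with distance at least two to the attachment vertex. -/
noncomputable def farPath (a : ι → Fin 5 → V) (p : ι) : Finset V :=
  Finset.univ.filter fun v => ∃ j, j ≠ 0 ∧ v = a p j

theorem mem_farPath {p : ι} {v : V} : v ∈ farPath a p ↔ ∃ j, j ≠ 0 ∧ v = a p j := by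
  simp [farPath]

open Classical in
theorem HasPaths.isNeutralBlock (h : HasPaths G b x a) {D : Finset V} (p : ι) (hx : b x ∈ D)
    (h0 : a p 0 ∈ D) (hfar : ∀ j, j ≠ 0 → a p j ∉ D) : IsNeutralBlock G D (farPath a p) := by
  have near {q v : V} (hq : q ∈ farPath a p) (hv : q ∈ closedNbhd G v) :
      ∃ i j, j ≠ 0 ∧ q = a p j ∧ v = a p i ∧ PathNear i j := by
    obtain ⟨j, hj, rfl⟩ := mem_farPath.mp hq
    rcases h.eq_of_path_mem_closedNbhd hv with hv | ⟨i, hi, hij⟩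
    · exact absurd hv.1 hj
    · exact ⟨i, j, hj, rfl, hi, hij⟩
  have pair {i i' : Fin 5} (hii : ∀ j, j ≠ 0 → PathNear i j ∨ PathNear i' j) :
      farPath a p ⊆ closedNbhd G (a p i) ∪ closedNbhd G (a p i') := fun q hq => by
    obtain ⟨j, hj, rfl⟩ := mem_farPath.mp hq
    rw [Finset.mem_union, h.path_mem_closedNbhd_iff, h.path_mem_closedNbhd_iff]
    exact hii j hj
  refine ⟨fun q hq => ?_, fun v q hq hv w hw => ?_, fun v hs => ?_, fun v q hq hv => ?_,
    -- `a p 3` dominates all of the block but `a p 1`, so the next move touching the rest completes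
    -- it.
    a p 3, ⟨a p 3, mem_farPath.mpr ⟨3, by decide, rfl⟩, self_mem_closedNbhd G _⟩,
    fun w q hq hw hq3 => ?_⟩
  · obtain ⟨j, hj, rfl⟩ := mem_farPath.mp hq
    exact hfar j hj
  · obtain ⟨i, j, hj, rfl, rfl, hij⟩ := near hq hv
    rw [Finset.mem_union, mem_farPath]
    rcases (h.mem_closedNbhd_iff p i w).mp hw with hw | ⟨k, rfl, -⟩
    · exact .inl (hw.2 ▸ hx)
    · by_cases hk : k = 0
      · exact .inl (hk ▸ h0)
      · exact .inr ⟨k, hk, rfl⟩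
  · have hmem {j : Fin 5} (hj : j ≠ 0) : a p j ∈ closedNbhd G v := hs (mem_farPath.mpr ⟨j, hj, rfl⟩)
    obtain ⟨i, -, -, -, rfl, -⟩ := near (mem_farPath.mpr ⟨1, by decide, rfl⟩) (hmem (by decide))
    have hall (j : Fin 5) (hj : j ≠ 0) : PathNear i j := (h.path_mem_closedNbhd_iff p i j).mp (hmem hj)
    have : ∀ i : Fin 5, ¬ ∀ j, j ≠ 0 → PathNear i j := by decide
    exact this i hall
  · obtain ⟨i, -, -, -, rfl, -⟩ := near hq hv
    have : ∀ i : Fin 5, ∃ i', ∀ j, j ≠ 0 → PathNear i j ∨ PathNear i' j := by decide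
    obtain ⟨i', hi'⟩ := this i
    exact ⟨a p i', pair hi'⟩
  · obtain ⟨i, j, hj, rfl, rfl, hij⟩ := near hq hw
    rw [h.path_mem_closedNbhd_iff] at hq3
    have : ∀ i j : Fin 5, PathNear i j → ¬ PathNear 3 j → j ≠ 0 →
        ∀ k, k ≠ 0 → PathNear 3 k ∨ PathNear i k := by decide
    exact pair (this i j hij hq3 hj)

open Classical in
/-- Once `x` and its neighbours on the pendant paths are dominated, every pendant path contributes
two moves, and the rest of the game takes place among the vertices `b i`. -/
theorem HasPaths.gameValue_eq [Fintype ι] (h : HasPaths G b x a) {D : Finset V} (hx : b x ∈ D)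
    (h0 : ∀ p, a p 0 ∈ D) (hfar : ∀ p j, j ≠ 0 → a p j ∉ D) :
    ∃ E : Finset V, (∀ i, b i ∈ E ↔ b i ∈ D) ∧ Idle G b E ∧
      ∀ p, gameValue G p D = gameValue G p E + 2 * Fintype.card ι := by
  refine ⟨D ∪ Finset.univ.biUnion (farPath a), fun i => ?_, fun v hv w hw => ?_, fun p => ?_⟩
  · rw [Finset.mem_union, or_iff_left]
    intro hi
    obtain ⟨p, -, hp⟩ := Finset.mem_biUnion.mp hi
    obtain ⟨j, -, hj⟩ := mem_farPath.mp hp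
    exact h.sep i p j hj
  · obtain ⟨p, i, rfl⟩ := (h.cover v).resolve_left hv
    rw [Finset.mem_union]
    rcases (h.mem_closedNbhd_iff p i w).mp hw with hw | ⟨j, rfl, -⟩
    · exact .inl (hw.2 ▸ hx)
    · by_cases hj : j = 0
      · exact .inl (hj ▸ h0 p)
      · exact .inr (Finset.mem_biUnion.mpr ⟨p, Finset.mem_univ p, mem_farPath.mpr ⟨j, hj, rfl⟩⟩)
  · rw [gameValue_biUnion_neutralBlocks (farPath a)
      (fun p => h.isNeutralBlock p hx (h0 p) (hfar p)) ?_ Finset.univ p, Finset.card_univ]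
    intro p q hpq v hv hv'
    obtain ⟨j, -, rfl⟩ := mem_farPath.mp hv
    obtain ⟨k, -, hk⟩ := mem_farPath.mp hv'
    exact hpq (h.inj p q j k hk).1

open Classical in
-- `l` bounds the moves on the base once `N[x]` is dominated; the additional 2 accounts for
-- Staller's opening and the answer `x`.
theorem HasPaths.stallerStartNumber_eq [Fintype ι] (h : HasPaths G b x a)
    (hb : Function.Injective b) {f : Fin n → ℕ}
    (hf : ∀ i, Codes b (closedNbhd G (b i)) (f i)) {N N' : List ℕ} (hN : List.ofFn f = N)
    (hN' : ∀ t ∈ N', t ∈ N) {l : ℕ}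
    (hupper : searchUpper N l .staller (f x) = true)
    (hlower : searchLower N N' (l + 2) .staller (2 ^ x.val) = true) :
    stallerStartNumber G = 2 * Fintype.card ι + (l + 2) := by
  subst hN
  apply le_antisymm
  · have hx0 (p : ι) : a p 0 ∈ closedNbhd G (b x) := by
      have : b x ∈ closedNbhd G (a p 0) := (h.mem_closedNbhd_iff p 0 _).mpr (.inl ⟨rfl, rfl⟩)
      rw [mem_closedNbhd] at this ⊢
      exact this.imp Eq.symm SimpleGraph.Adj.symm
    have hfar (p : ι) (j : Fin 5) (hj : j ≠ 0) : a p j ∉ closedNbhd G (b x) := fun hm => by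
      rcases h.eq_of_path_mem_closedNbhd hm with hm | ⟨i, hi, -⟩
      · exact hj hm.1
      · exact h.sep x p i hi
    obtain ⟨E, hE, hidle, hval⟩ := h.gameValue_eq (self_mem_closedNbhd G (b x)) hx0 hfar
    have h1 := stallerStartNumber_le_of_move G (b x)
    have h2 := gameValue_le_of_searchUpper hf ((hf x).congr hE) hidle hupper
    rw [hval] at h1
    omega
  -- This position need not occur in play; it is the least gift that makes every path a neutral
  -- block, and it can only shorten the game.
  · let D : Finset V := Finset.univ.filter fun v => v = b x ∨ ∃ p, v = a p 0
    have hmem (v : V) : v ∈ D ↔ v = b x ∨ ∃ p, v = a p 0 := by simp [D]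
    obtain ⟨E, hE, hidle, hval⟩ := h.gameValue_eq (D := D) ((hmem _).mpr (.inl rfl))
      (fun p => (hmem _).mpr (.inr ⟨p, rfl⟩)) fun p j hj hm => by
        rcases (hmem _).mp hm with hm | ⟨q, hq⟩
        · exact h.sep x p j hm.symm
        · exact hj (h.inj p q j 0 hq).2
    have hD : Codes b D (2 ^ x.val) := by
      refine ⟨Nat.pow_lt_pow_right one_lt_two x.isLt, fun i => ?_⟩
      rw [hmem, Nat.testBit_two_pow]
      simp only [decide_eq_true_eq]
      constructor
      · rintro (hi | ⟨p, hp⟩)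
        · rw [hb hi]
        · exact absurd hp (h.sep i p 0)
      · exact fun hi => .inl (by rw [Fin.ext hi.symm])
    have h1 := le_gameValue_of_searchLower hf hN' (hD.congr hE) hidle hlower
    have h2 : gameValue G .staller D ≤ stallerStartNumber G :=
      gameValue_antitone G .staller (Finset.empty_subset D)
    rw [hval] at h2
    omega

end AttachedPaths

/-! ### The graphs `U_k` and `V_k`, their masks and their values. -/

section Gadgets

/-- `G` consists of `H`, the graph `B` on five vertices and `k` pendant paths, with `h` joined to
the vertex `0` of `B` and the paths attached to that vertex. -/
structure IsGadget {W : Type*} {k : ℕ} (G : SimpleGraph (GadgetVertex W k)) (H : SimpleGraph W)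
    (h : W) (B : SimpleGraph (Fin 5)) : Prop where
  adj_left : ∀ u v, G.Adj (.inl u) (.inl v) ↔ H.Adj u v
  adj_join : ∀ u j, G.Adj (.inl u) (.inr (.inl j)) ↔ u = h ∧ j = 0
  adj_far : ∀ u q, ¬ G.Adj (.inl u) (.inr (.inr q))
  adj_star : ∀ i j, G.Adj (.inr (.inl i)) (.inr (.inl j)) ↔ B.Adj i j
  adj_attach : ∀ i p j, G.Adj (.inr (.inl i)) (.inr (.inr (p, j))) ↔ i = 0 ∧ j = 0
  adj_path : ∀ p q i j, G.Adj (.inr (.inr (p, i))) (.inr (.inr (q, j))) ↔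
    p = q ∧ (SimpleGraph.pathGraph 5).Adj i j

theorem isGadget_gadget {W : Type*} (H : SimpleGraph W) (h : W) (k : ℕ) :
    IsGadget (gadget H h k) H h graphB where
  adj_left u v := by
    simp only [gadget, SimpleGraph.fromRel_adj, H.adj_comm v u, or_self]
    exact ⟨fun h => h.2, fun h => ⟨by simpa using h.ne, h⟩⟩
  adj_join u j := by simp [gadget, SimpleGraph.fromRel_adj]
  adj_far u q := by simp [gadget, SimpleGraph.fromRel_adj]
  adj_star i j := by
    simp only [gadget, SimpleGraph.fromRel_adj, graphB.adj_comm j i, or_self]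
    exact ⟨fun h => h.2, fun h => ⟨by simpa using h.ne, h⟩⟩
  adj_attach i p j := by simp [gadget, SimpleGraph.fromRel_adj]
  adj_path p q i j := by
    simp only [gadget, SimpleGraph.fromRel_adj, (SimpleGraph.pathGraph 5).adj_comm j i, eq_comm (a := q),
      or_self]
    exact ⟨fun h => h.2, fun h => ⟨by simpa using fun _ => h.2.ne, h⟩⟩

/-- The edge `e` lies inside `B`, so a gadget with and without `e` is treated uniformly by letting
`B` vary. -/
theorem IsGadget.deleteEdges {W : Type*} {k : ℕ} {G : SimpleGraph (GadgetVertex W k)}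
    {H : SimpleGraph W} {h : W} {B : SimpleGraph (Fin 5)} (hG : IsGadget G H h B) :
    IsGadget (G.deleteEdges {gadgetEdge W k}) H h (B.deleteEdges {s(0, 3)}) where
  adj_left u v := by simp [gadgetEdge, hG.adj_left]
  adj_join u j := by simp [gadgetEdge, hG.adj_join]
  adj_far u q := by simp [hG.adj_far]
  adj_star i j := by simp [gadgetEdge, hG.adj_star]
  adj_attach i p j := by simp [gadgetEdge, hG.adj_attach]
  adj_path p q i j := by simp [gadgetEdge, hG.adj_path]

theorem connected_of_forall_reachable {V : Type*} {G : SimpleGraph V} (x : V)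
    (h : ∀ v, G.Reachable x v) : G.Connected :=
  have : Nonempty V := ⟨x⟩
  ⟨fun u v => (h u).symm.trans (h v)⟩

variable {k : ℕ}

theorem IsGadget.connected {W : Type*} {G : SimpleGraph (GadgetVertex W k)}
    {H : SimpleGraph W} {h : W} {B : SimpleGraph (Fin 5)} (hG : IsGadget G H h B)
    (hH : H.Connected) (hB : B.Connected) : G.Connected := by
  refine connected_of_forall_reachable (.inr (.inl 0)) fun v => ?_
  let φ : H →g G := ⟨Sum.inl, fun {u v} huv => (hG.adj_left u v).mpr huv⟩
  let ψ : B →g G := ⟨fun i => .inr (.inl i), fun {i j} hij => (hG.adj_star i j).mpr hij⟩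
  let π (p : Fin k) : SimpleGraph.pathGraph 5 →g G :=
    ⟨fun i => .inr (.inr (p, i)), fun {i j} hij => (hG.adj_path p p i j).mpr ⟨rfl, hij⟩⟩
  match v with
  | .inl u =>
    exact ((hG.adj_join h 0).mpr ⟨rfl, rfl⟩).symm.reachable.trans ((hH.preconnected h u).map φ)
  | .inr (.inl i) => exact (hB.preconnected 0 i).map ψ
  | .inr (.inr (p, i)) =>
    exact ((hG.adj_attach 0 p 0).mpr ⟨rfl, rfl⟩).reachable.trans
      (((SimpleGraph.pathGraph_connected 4).preconnected 0 i).map (π p))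

variable {m : ℕ}

/-- The vertices of a gadget graph that do not lie on the pendant paths. -/
def gadgetBase (m k : ℕ) : Fin (m + 5) → GadgetVertex (Fin m) k :=
  Fin.append Sum.inl fun i => .inr (.inl i)

theorem gadgetBase_castAdd (i : Fin m) : gadgetBase m k (Fin.castAdd 5 i) = .inl i :=
  Fin.append_left _ _ i

theorem gadgetBase_natAdd (i : Fin 5) : gadgetBase m k (Fin.natAdd m i) = .inr (.inl i) :=
  Fin.append_right _ _ i

theorem gadgetBase_injective : Function.Injective (gadgetBase m k) := by
  intro i j
  refine Fin.addCases (fun i => ?_) (fun i => ?_) i <;>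
  refine Fin.addCases (fun j => ?_) (fun j => ?_) j <;>
  simp [gadgetBase_castAdd, gadgetBase_natAdd]

variable {G : SimpleGraph (GadgetVertex (Fin m) k)} {H : SimpleGraph (Fin m)} {h : Fin m}
  {B : SimpleGraph (Fin 5)}

theorem IsGadget.hasPaths (hG : IsGadget G H h B) :
    HasPaths G (gadgetBase m k) (Fin.natAdd m 0) fun (p : Fin k) i => .inr (.inr (p, i)) where
  cover v := match v with
    | .inl u => .inl ⟨Fin.castAdd 5 u, gadgetBase_castAdd u⟩
    | .inr (.inl i) => .inl ⟨Fin.natAdd m i, gadgetBase_natAdd i⟩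
    | .inr (.inr (p, i)) => .inr ⟨p, i, rfl⟩
  sep i p j := by
    refine Fin.addCases (fun i => ?_) (fun i => ?_) i <;>
    simp [gadgetBase_castAdd, gadgetBase_natAdd]
  inj p q i j := by simp
  adj p i v := by
    rw [gadgetBase_natAdd]
    match v with
    | .inl u => simp [G.adj_comm _ (Sum.inl u), hG.adj_far]
    | .inr (.inl j) =>
      rw [G.adj_comm, hG.adj_attach]
      simp [and_comm]
    | .inr (.inr (q, j)) =>
      rw [hG.adj_path]
      simp [eq_comm, and_assoc]

/-- The numbers `f` code the closed neighbourhoods of the vertices in `gadgetBase`. -/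
structure IsCoding (f : Fin (m + 5) → ℕ) (H : SimpleGraph (Fin m)) (h : Fin m)
    (B : SimpleGraph (Fin 5)) : Prop where
  lt : ∀ i, f i < 2 ^ (m + 5)
  left : ∀ i j : Fin m, (f (Fin.castAdd 5 i)).testBit j = true ↔ j = i ∨ H.Adj i j
  join : ∀ (i : Fin m) (j : Fin 5), (f (Fin.castAdd 5 i)).testBit (m + j) = true ↔ i = h ∧ j = 0
  join' : ∀ (i : Fin 5) (j : Fin m), (f (Fin.natAdd m i)).testBit j = true ↔ j = h ∧ i = 0
  right : ∀ i j : Fin 5, (f (Fin.natAdd m i)).testBit (m + j) = true ↔ j = i ∨ B.Adj i j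

theorem IsCoding.codes {f : Fin (m + 5) → ℕ} (hf : IsCoding f H h B) (hG : IsGadget G H h B)
    (i : Fin (m + 5)) : Codes (gadgetBase m k) (closedNbhd G (gadgetBase m k i)) (f i) where
  lt := hf.lt i
  mem_iff j := by
    rw [mem_closedNbhd]
    refine Fin.addCases (fun i => ?_) (fun i => ?_) i <;>
    refine Fin.addCases (fun j => ?_) (fun j => ?_) j
    · rw [gadgetBase_castAdd, gadgetBase_castAdd, hG.adj_left, Fin.val_castAdd, hf.left,
        Sum.inl.injEq]
    · rw [gadgetBase_castAdd, gadgetBase_natAdd, hG.adj_join, Fin.val_natAdd, hf.join]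
      simp
    · rw [gadgetBase_castAdd, gadgetBase_natAdd, G.adj_comm, hG.adj_join, Fin.val_castAdd, hf.join']
      simp
    · rw [gadgetBase_natAdd, gadgetBase_natAdd, hG.adj_star, Fin.val_natAdd, hf.right,
        Sum.inr.injEq, Sum.inl.injEq]

theorem IsGadget.stallerStartNumber_eq (hG : IsGadget G H h B) {f : Fin (m + 5) → ℕ}
    (hf : IsCoding f H h B) {N N' : List ℕ} (hN : List.ofFn f = N) (hN' : ∀ t ∈ N', t ∈ N) {l : ℕ}
    (hupper : searchUpper N l .staller (f (Fin.natAdd m 0)) = true)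
    -- Bit `m` is `x`, the first vertex of `B` after the `m` vertices of `H`.
    (hlower : searchLower N N' (l + 2) .staller (2 ^ m) = true) :
    stallerStartNumber G = 2 * k + (l + 2) := by
  rw [hG.hasPaths.stallerStartNumber_eq gadgetBase_injective (hf.codes hG) hN hN' hupper hlower,
    Fintype.card_fin]

theorem graphB_adj (i j : Fin 5) : graphB.Adj i j ↔
    i ≠ j ∧ s(i, j) ∈ [s(0, 1), s(0, 2), s(0, 3), s(0, 4), s(3, 4)] := by
  simp [graphB, and_comm]

theorem graphZ_adj (i j : Fin 9) : graphZ.Adj i j ↔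
    i ≠ j ∧ s(i, j) ∈ [s(0, 1), s(1, 2), s(2, 3), s(3, 8), s(8, 7), s(7, 6), s(6, 5), s(5, 0),
      s(6, 1), s(7, 4), s(4, 3), s(4, 8), s(2, 7)] := by
  simp [graphZ, and_comm]

instance : DecidableRel graphB.Adj := fun i j => decidable_of_iff _ (graphB_adj i j).symm

instance : DecidableRel graphZ.Adj := fun i j => decidable_of_iff _ (graphZ_adj i j).symm

theorem graphB_deleteEdges_connected : (graphB.deleteEdges {s(0, 3)}).Connected := by
  have h (i j : Fin 5) (hij : graphB.Adj i j) (hne : s(i, j) ≠ s(0, 3)) :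
      (graphB.deleteEdges {s(0, 3)}).Reachable i j :=
    (SimpleGraph.deleteEdges_adj.mpr ⟨hij, by simpa using hne⟩).reachable
  refine connected_of_forall_reachable 0 fun v => ?_
  match v with
  | 0 => rfl
  | 1 => exact h 0 1 (by decide) (by decide)
  | 2 => exact h 0 2 (by decide) (by decide)
  | 3 => exact (h 0 4 (by decide) (by decide)).trans (h 4 3 (by decide) (by decide))
  | 4 => exact h 0 4 (by decide) (by decide)

theorem graphZ_connected : graphZ.Connected := by
  have h {i j : Fin 9} (hi : graphZ.Reachable 8 i) (hij : graphZ.Adj i j) :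
      graphZ.Reachable 8 j := hi.trans hij.reachable
  have h3 : graphZ.Reachable 8 3 := h .rfl (by decide)
  have h7 : graphZ.Reachable 8 7 := h .rfl (by decide)
  have h2 : graphZ.Reachable 8 2 := h h3 (by decide)
  have h1 : graphZ.Reachable 8 1 := h h2 (by decide)
  have h6 : graphZ.Reachable 8 6 := h h7 (by decide)
  refine connected_of_forall_reachable 8 fun v => ?_
  match v with
  | 0 => exact h h1 (by decide)
  | 1 => exact h1
  | 2 => exact h2
  | 3 => exact h3
  | 4 => exact h h3 (by decide)
  | 5 => exact h h6 (by decide)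
  | 6 => exact h6
  | 7 => exact h7
  | 8 => rfl

theorem gadgetEdge_mem (W : Type*) (H : SimpleGraph W) (h : W) (k : ℕ) :
    gadgetEdge W k ∈ (gadget H h k).edgeSet :=
  ((isGadget_gadget H h k).adj_star 0 3).mpr (by decide)

theorem gadget_deleteEdges_connected {W : Type*} {H : SimpleGraph W} (hH : H.Connected) (h : W)
    (k : ℕ) : ((gadget H h k).deleteEdges {gadgetEdge W k}).Connected :=
  (isGadget_gadget H h k).deleteEdges.connected hH graphB_deleteEdges_connected

theorem gadget_connected {W : Type*} {H : SimpleGraph W} (hH : H.Connected) (h : W)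
    (k : ℕ) : (gadget H h k).Connected :=
  (gadget_deleteEdges_connected hH h k).mono (SimpleGraph.deleteEdges_le _)

theorem isCoding_graphU : IsCoding (m := 6)
    ![99, 7, 14, 28, 56, 49, 1985, 192, 320, 1600, 1600] (SimpleGraph.cycleGraph 6) 0 graphB := by
  constructor <;> decide

/-- Compared with the masks of `U_k`, only those of the two ends of `e` change: bit 9 leaves the
mask of `x`, and bit 6 that of the triangle vertex. -/
theorem isCoding_graphU_deleteEdges : IsCoding (m := 6)
    ![99, 7, 14, 28, 56, 49, 1473, 192, 320, 1536, 1600] (SimpleGraph.cycleGraph 6) 0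
    (graphB.deleteEdges {s(0, 3)}) := by
  constructor
  case right =>
    simp only [SimpleGraph.deleteEdges_adj, Set.mem_singleton_iff]
    decide
  all_goals decide

theorem isCoding_graphV : IsCoding (m := 9)
    ![35, 71, 142, 284, 408, 97, 226, 468, 920, 16128, 1536, 2560, 12800, 12800] graphZ 8
    graphB := by
  constructor <;> decide

theorem isCoding_graphV_deleteEdges : IsCoding (m := 9)
    ![35, 71, 142, 284, 408, 97, 226, 468, 920, 12032, 1536, 2560, 12288, 12800] graphZ 8
    (graphB.deleteEdges {s(0, 3)}) := by
  constructor
  case right =>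
    simp only [SimpleGraph.deleteEdges_adj, Set.mem_singleton_iff]
    decide
  all_goals decide

theorem stallerStartNumber_graphU (k : ℕ) : stallerStartNumber (graphU k) = 2 * k + 4 :=
  (isGadget_gadget (SimpleGraph.cycleGraph 6) 0 k).stallerStartNumber_eq isCoding_graphU
    (N := [99, 7, 14, 28, 56, 49, 1985, 192, 320, 1600, 1600])
    -- A lower bound needs only one good move of Staller at each turn, so `N'` lists just a
    -- sufficient selection.
    (N' := [1985, 28, 14]) (l := 2) rfl (by decide) (by decide +kernel) (by decide +kernel)

theorem stallerStartNumber_graphU_deleteEdges (k : ℕ) :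
    stallerStartNumber ((graphU k).deleteEdges {gadgetEdge (Fin 6) k}) = 2 * k + 6 :=
  (isGadget_gadget (SimpleGraph.cycleGraph 6) 0 k).deleteEdges.stallerStartNumber_eq
    isCoding_graphU_deleteEdges
    (N := [99, 7, 14, 28, 56, 49, 1473, 192, 320, 1536, 1600])
    -- Two more than for `U_k`: the price of the triangle vertex that `x` no longer dominates.
    (N' := [192, 28, 1473, 14, 1536]) (l := 4) rfl (by decide) (by decide +kernel)
    (by decide +kernel)

theorem stallerStartNumber_graphV (k : ℕ) : stallerStartNumber (graphV k) = 2 * k + 5 :=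
  (isGadget_gadget graphZ 8 k).stallerStartNumber_eq isCoding_graphV
    (N := [35, 71, 142, 284, 408, 97, 226, 468, 920, 16128, 1536, 2560, 12800, 12800])
    (N' := [16128, 468, 920, 71, 97, 35, 284]) (l := 3) rfl (by decide) (by decide +kernel)
    (by decide +kernel)

theorem stallerStartNumber_graphV_deleteEdges (k : ℕ) :
    stallerStartNumber ((graphV k).deleteEdges {gadgetEdge (Fin 9) k}) = 2 * k + 7 :=
  (isGadget_gadget graphZ 8 k).deleteEdges.stallerStartNumber_eq isCoding_graphV_deleteEdges
    (N := [35, 71, 142, 284, 408, 97, 226, 468, 920, 12032, 1536, 2560, 12288, 12800])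
    (N' := [1536, 2560, 408, 12032, 12800, 284, 468, 226, 35, 97]) (l := 5) rfl (by decide)
    (by decide +kernel) (by decide +kernel)

end Gadgets

end DominationGame

theorem mainTheorem7 :
    -- every `ℓ ≥ 4` is realized
    (∀ l : ℕ, 4 ≤ l →
      ∃ (V : Type) (_ : Fintype V) (G : SimpleGraph V) (e : Sym2 V),
        G.Connected ∧ e ∈ G.edgeSet ∧ (G.deleteEdges {e}).Connected ∧
        DominationGame.stallerStartNumber G = l ∧
        DominationGame.stallerStartNumber (G.deleteEdges {e}) = l + 2) ∧
    -- the realizing family for even `ℓ`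
    (∀ k : ℕ,
      (DominationGame.graphU k).Connected ∧
      DominationGame.gadgetEdge (Fin 6) k ∈ (DominationGame.graphU k).edgeSet ∧
      ((DominationGame.graphU k).deleteEdges {DominationGame.gadgetEdge (Fin 6) k}).Connected ∧
      DominationGame.stallerStartNumber (DominationGame.graphU k) = 2 * k + 4 ∧
      DominationGame.stallerStartNumber
        ((DominationGame.graphU k).deleteEdges {DominationGame.gadgetEdge (Fin 6) k}) =
          2 * k + 6) ∧
    -- the realizing family for odd `ℓ`
    (∀ k : ℕ,
      (DominationGame.graphV k).Connected ∧
      DominationGame.gadgetEdge (Fin 9) k ∈ (DominationGame.graphV k).edgeSet ∧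
      ((DominationGame.graphV k).deleteEdges {DominationGame.gadgetEdge (Fin 9) k}).Connected ∧
      DominationGame.stallerStartNumber (DominationGame.graphV k) = 2 * k + 5 ∧
      DominationGame.stallerStartNumber
        ((DominationGame.graphV k).deleteEdges {DominationGame.gadgetEdge (Fin 9) k}) =
          2 * k + 7) ∧
    -- no `ℓ < 4` is realized, by any finite graph, connected or not
    (∀ l : ℕ, l < 4 →
      ¬ ∃ (V : Type*) (_ : Fintype V) (G : SimpleGraph V) (e : Sym2 V),
        e ∈ G.edgeSet ∧
        DominationGame.stallerStartNumber G = l ∧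
        DominationGame.stallerStartNumber (G.deleteEdges {e}) = l + 2) ∧
    -- the sharper bounds for `ℓ = 1, 2, 3`
    (∀ (V : Type*) [Fintype V] (G : SimpleGraph V) (e : Sym2 V), e ∈ G.edgeSet →
      (DominationGame.stallerStartNumber G = 1 →
        DominationGame.stallerStartNumber (G.deleteEdges {e}) = 2) ∧
      (DominationGame.stallerStartNumber G = 2 →
        DominationGame.stallerStartNumber (G.deleteEdges {e}) ≤ 3) ∧
      (DominationGame.stallerStartNumber G = 3 →
        DominationGame.stallerStartNumber (G.deleteEdges {e}) ≤ 4)) := by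
  open DominationGame in
  refine ⟨fun l hl => ?_, fun k => ?_, fun k => ?_, ?_, fun V _ G e he => ?_⟩
  · obtain ⟨k, rfl | rfl⟩ : ∃ k, l = 2 * k + 4 ∨ l = 2 * k + 5 := ⟨(l - 4) / 2, by omega⟩
    · exact ⟨_, inferInstance, graphU k, gadgetEdge _ k,
        gadget_connected SimpleGraph.cycleGraph_connected _ k, gadgetEdge_mem _ _ _ k,
        gadget_deleteEdges_connected SimpleGraph.cycleGraph_connected _ k,
        stallerStartNumber_graphU k, stallerStartNumber_graphU_deleteEdges k⟩
    · exact ⟨_, inferInstance, graphV k, gadgetEdge _ k,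
        gadget_connected graphZ_connected _ k, gadgetEdge_mem _ _ _ k,
        gadget_deleteEdges_connected graphZ_connected _ k,
        stallerStartNumber_graphV k, stallerStartNumber_graphV_deleteEdges k⟩
  · exact ⟨gadget_connected SimpleGraph.cycleGraph_connected _ k, gadgetEdge_mem _ _ _ k,
      gadget_deleteEdges_connected SimpleGraph.cycleGraph_connected _ k,
      stallerStartNumber_graphU k, stallerStartNumber_graphU_deleteEdges k⟩
  · exact ⟨gadget_connected graphZ_connected _ k, gadgetEdge_mem _ _ _ k,
      gadget_deleteEdges_connected graphZ_connected _ k,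
      stallerStartNumber_graphV k, stallerStartNumber_graphV_deleteEdges k⟩
  · rintro l hl ⟨V, _, G, e, he, h, h'⟩
    -- An end of `e` shows that `G` has a vertex, which excludes the value 0.
    have : Nonempty V := ⟨(Quot.out e).1⟩
    have h0 := stallerStartNumber_ne_zero G
    have h1 := stallerStartNumber_deleteEdges_of_eq_one G he
    have h2 := stallerStartNumber_deleteEdges_of_eq_two G (e := e)
    have h3 := stallerStartNumber_deleteEdges_of_eq_three G (e := e)
    omega
  · exact ⟨stallerStartNumber_deleteEdges_of_eq_one G he,
      stallerStartNumber_deleteEdges_of_eq_two G, stallerStartNumber_deleteEdges_of_eq_three G⟩
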